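/- Let $\eta=\operatorname{diag}(\eta_1,\dots,\eta_d)$ with $\eta_i\in\{1,-1\}$, let $\langle x,y\rangle=x^T\eta y$ on $\mathbb R^d$, and let $G_\eta(d)=\{O\in\mathbb R^{d\times d}: O^T\eta O=\eta\}$ act on matrices with $d$ rows by left multiplication. A vector $v\neq 0$ is called null if $\langle v,v\rangle=0$. Let $P\in\mathbb R^{d\times n}$ have no null columns, and let $\phi(P)=PM\in\mathbb R^{d\times d'}$ be formed by linearly independent columns of $P$, in their order, that span all columns of $P$. Let $\phi(P)=\hat Q\hat R$ be a generalized QR decomposition: there are $Q\in\mathbb R^{d\times d}$ with $Q^T\eta Q=D$ diagonal with entries $\pm1$, an upper triangular $R\in\mathbb R^{d\times d'}$ with positive diagonal entries such that $\phi(P)=QDR$, and a permutation matrix $S$ such that $\hat Q=QS\in G_\eta(d)$ and $\hat R=S^TDR$. Put $$\mathcal Q_P=\hat{\mathcal F}_\phi(\phi(P))=\{g\in G_\eta(d): g\hat R=\phi(P)\}=\hat Q\,\mathrm{Stab}_{G_\eta(d)}(\hat R).$$ A frame on $\mathbb R^{d\times n}$ is a map $\mathcal F$ to the non-empty subsets of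 $G_\eta(d)$ with $\mathcal F(gX)=g\mathcal F(X)$; it is minimal if for no $X$ there is a frame $\mathcal F'$ with $\mathcal F'(X)\subsetneq\mathcal F(X)$. A uniform probability measure on a set $\mathcal Q\subseteq G_\eta(d)$ is a Borel probability measure $\mu$ concentrated on $\mathcal Q$ such that $\mu(gX)=\mu(X)$ and $\mu(Xg)=\mu(X)$ whenever $X\subseteq\mathcal Q$ is Borel and the translate lies in $\mathcal Q$. Then $\mathcal Q_P$ is the value at $P$ of a minimal frame on $\mathbb R^{d\times n}$; it equals $\{\hat Q\}$ if $d'=d$; and it carries a uniform probability measure if and only if it is compact. Moreover, exactly $d'$ columns of $\hat Q$ are determined, i.e. shared by all elements of $\mathcal Q_P$. Let $Q_0\in\mathbb R^{d\times d}$ have these $d'$ columns in common with $\hat Q$ and its other $d-d'$ columns equal to $0$. Then for every function $\Phi:\mathbb R^{d\times n}\to\mathbb R^{d\times n}$ the frame average of $\Phi$ over $\mathcal Q_P$ is $Q_0\,\Phi(\hat Q^{-1}P)$, that is: (i) if $\mathcal Q_P$ is finite (in particular if $d'=d$), then $$\frac1{|\mathcal Q_P|}\sum_{g\in\mathcal Q_P}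 g\,\Phi(g^{-1}P)=Q_0\,\Phi(\hat Q^{-1}P);$$ (ii) for every uniform probability measure $\mu$ on $\mathcal Q_P$, the function $g\mapsto g\,\Phi(g^{-1}P)$ is integrable over $\mathcal Q_P$ and $$\int_{\mathcal Q_P} g\,\Phi(g^{-1}P)\,d\mu(g)=Q_0\,\Phi(\hat Q^{-1}P).$$ -/

import Mathlib

open MeasureTheory Matrix

noncomputable section

namespace MFA

/-- The pseudo-inner product `⟨x, y⟩ = xᵀ η y`, where `η` is given by its diagonal. -/
def pseudoInner {d : ℕ} (η : Fin d → ℝ) (x y : Fin d → ℝ) : ℝ :=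
  x ⬝ᵥ (diagonal η *ᵥ y)

/-- A nonzero vector is null if its pseudo-inner product with itself vanishes. -/
def IsNull {d : ℕ} (η : Fin d → ℝ) (x : Fin d → ℝ) : Prop :=
  x ≠ 0 ∧ pseudoInner η x x = 0

/-- The linear algebraic group `G_η(d) = {O | Oᵀ η O = η}`. -/
def Geta {d : ℕ} (η : Fin d → ℝ) : Subgroup (GL (Fin d) ℝ) where
  carrier := {g | (g : Matrix (Fin d) (Fin d) ℝ)ᵀ * diagonal η *
    (g : Matrix (Fin d) (Fin d) ℝ) = diagonal η}
  one_mem' := by simp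
  mul_mem' := by
    intro a b ha hb
    simp only [Set.mem_ofPred_eq, Units.val_mul, transpose_mul] at *
    calc _ = (b : Matrix (Fin d) (Fin d) ℝ)ᵀ * ((a : Matrix (Fin d) (Fin d) ℝ)ᵀ * diagonal η *
          (a : Matrix (Fin d) (Fin d) ℝ)) * (b : Matrix (Fin d) (Fin d) ℝ) := by
          simp only [Matrix.mul_assoc]
      _ = _ := by rw [ha, hb]
  inv_mem' := by
    intro a ha
    simp only [Set.mem_ofPred_eq] at *
    have h1 : (a : Matrix (Fin d) (Fin d) ℝ) * ((a⁻¹ : GL (Fin d) ℝ) : Matrix _ _ ℝ) = 1 :=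
      a.mul_inv
    have h2 : ((a⁻¹ : GL (Fin d) ℝ) : Matrix _ _ ℝ)ᵀ * (a : Matrix (Fin d) (Fin d) ℝ)ᵀ = 1 := by
      rw [← transpose_mul, h1, transpose_one]
    calc _ = ((a⁻¹ : GL (Fin d) ℝ) : Matrix _ _ ℝ)ᵀ * ((a : Matrix (Fin d) (Fin d) ℝ)ᵀ *
          diagonal η * (a : Matrix (Fin d) (Fin d) ℝ)) *
          ((a⁻¹ : GL (Fin d) ℝ) : Matrix _ _ ℝ) := by rw [ha]
      _ = (((a⁻¹ : GL (Fin d) ℝ) : Matrix _ _ ℝ)ᵀ * (a : Matrix (Fin d) (Fin d) ℝ)ᵀ) *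
          diagonal η * ((a : Matrix (Fin d) (Fin d) ℝ) *
          ((a⁻¹ : GL (Fin d) ℝ) : Matrix _ _ ℝ)) := by simp only [Matrix.mul_assoc]
      _ = _ := by rw [h1, h2, Matrix.one_mul, Matrix.mul_one]

/-- `G_η(d)` carries its Borel σ-algebra. -/
instance {d : ℕ} (η : Fin d → ℝ) : MeasurableSpace (Geta η) := borel _

instance {d : ℕ} (η : Fin d → ℝ) : BorelSpace (Geta η) := ⟨rfl⟩

/-- The defining representation; `g` acts on `d × m` matrices by `X ↦ rho g * X`. -/
def rho {d : ℕ} {η : Fin d → ℝ} (g : Geta η) : Matrix (Fin d) (Fin d) ℝ :=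
  ((g : GL (Fin d) ℝ) : Matrix (Fin d) (Fin d) ℝ)

/-- A `G_η(d)`-equivariant frame on `ℝ^{d × n}`. -/
def IsFrame {d : ℕ} (η : Fin d → ℝ) {n : ℕ}
    (F : Matrix (Fin d) (Fin n) ℝ → Set (Geta η)) : Prop :=
  (∀ P, (F P).Nonempty) ∧ ∀ (g : Geta η) P, F (rho g * P) = (fun h => g * h) '' F P

/-- A frame none of whose values properly contains the value of another frame. -/
def IsMinimalFrame {d : ℕ} (η : Fin d → ℝ) {n : ℕ}
    (F : Matrix (Fin d) (Fin n) ℝ → Set (Geta η)) : Prop :=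
  IsFrame η F ∧ ∀ P F', IsFrame η F' → ¬ F' P ⊂ F P

/-- The increasing family `sel` of column indices is a valid choice of columns of `P`: the chosen
columns are not null and linearly independent, and every non-null column is a combination of
them. -/
structure IsSelection {d n d' : ℕ} (η : Fin d → ℝ) (P : Matrix (Fin d) (Fin n) ℝ)
    (sel : Fin d' ↪o Fin n) : Prop where
  not_null : ∀ j, ¬ IsNull η (P.col (sel j))
  linearIndependent : LinearIndependent ℝ fun j => P.col (sel j)
  mem_span : ∀ j, ¬ IsNull η (P.col j) →
    P.col j ∈ Submodule.span ℝ (Set.range fun i => P.col (sel i))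

/-- The matrix `M` obtained from the identity by keeping only the selected columns. -/
def selMatrix {n d' : ℕ} (sel : Fin d' ↪o Fin n) : Matrix (Fin n) (Fin d') ℝ :=
  (1 : Matrix (Fin n) (Fin n) ℝ).submatrix id sel

/-- `φ(P) = P M`. -/
def phi {d n d' : ℕ} (sel : Fin d' ↪o Fin n) (P : Matrix (Fin d) (Fin n) ℝ) :
    Matrix (Fin d) (Fin d') ℝ :=
  P * selMatrix sel

/-- `A = Q̂ R̂` is a generalized QR decomposition: there are `Q` with `η`-orthonormal columns,
`Qᵀ η Q = D` with `D = diag(ε)`, `ε = ±1`, an upper triangular `R` with positive diagonal such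
that `A = Q D R`, and a permutation matrix `S` with `Q̂ = Q S ∈ G_η(d)` and `R̂ = Sᵀ D R`. -/
def IsGenQR {d m : ℕ} (η : Fin d → ℝ) (A : Matrix (Fin d) (Fin m) ℝ)
    (Qhat : Geta η) (Rhat : Matrix (Fin d) (Fin m) ℝ) : Prop :=
  ∃ (Q : Matrix (Fin d) (Fin d) ℝ) (ε : Fin d → ℝ) (R : Matrix (Fin d) (Fin m) ℝ)
    (σ : Equiv.Perm (Fin d)),
    (∀ i, ε i = 1 ∨ ε i = -1) ∧
    Qᵀ * diagonal η * Q = diagonal ε ∧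
    (∀ i j, j.val < i.val → R i j = 0) ∧
    (∀ i j, i.val = j.val → 0 < R i j) ∧
    A = Q * diagonal ε * R ∧
    rho Qhat = Q * σ.permMatrix ℝ ∧
    Rhat = (σ.permMatrix ℝ)ᵀ * diagonal ε * R

/-- The minimal frame at `A` given by the canonical form `Rhat` of `A`: the set of all `g` with
`g · Rhat = A`, that is, `h Stab(Rhat)` for any `h` with `h · Rhat = A`. -/
def qrFrame {d m : ℕ} (η : Fin d → ℝ) (A Rhat : Matrix (Fin d) (Fin m) ℝ) : Set (Geta η) :=
  {g | rho g * Rhat = A}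

/-- `μ` is a uniform probability measure on the subset `F` of the group: it is concentrated on
`F`, and translates of a Borel set inside `F` that stay inside `F` have the same measure. -/
structure IsUniformOn {d : ℕ} {η : Fin d → ℝ} (F : Set (Geta η)) (μ : Measure (Geta η)) :
    Prop where
  prob : IsProbabilityMeasure μ
  concentrated : μ Fᶜ = 0
  left_invariant : ∀ (g : Geta η) (X : Set (Geta η)), MeasurableSet X → X ⊆ F →
    (fun h => g * h) '' X ⊆ F → μ ((fun h => g * h) '' X) = μ X
  right_invariant : ∀ (g : Geta η) (X : Set (Geta η)), MeasurableSet X → X ⊆ F →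
    (fun h => h * g) '' X ⊆ F → μ ((fun h => h * g) '' X) = μ X

/-- The averaged quantity `ρ(g) Φ(ρ(g⁻¹) P)`. -/
def twist {d n : ℕ} {η : Fin d → ℝ}
    (Φ : Matrix (Fin d) (Fin n) ℝ → Matrix (Fin d) (Fin n) ℝ)
    (P : Matrix (Fin d) (Fin n) ℝ) (g : Geta η) : Matrix (Fin d) (Fin n) ℝ :=
  rho g * Φ (rho g⁻¹ * P)

/-- Frame averaging at `P` over a finite frame value `F`. -/
def finFrameAverage {d n : ℕ} {η : Fin d → ℝ} (F : Finset (Geta η))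
    (Φ : Matrix (Fin d) (Fin n) ℝ → Matrix (Fin d) (Fin n) ℝ)
    (P : Matrix (Fin d) (Fin n) ℝ) : Matrix (Fin d) (Fin n) ℝ :=
  (F.card : ℝ)⁻¹ • ∑ g ∈ F, twist Φ P g

/-- Frame averaging at `P` over the frame value `F` against `μ`, computed entry by entry. -/
def frameAverage {d n : ℕ} {η : Fin d → ℝ} (F : Set (Geta η)) (μ : Measure (Geta η))
    (Φ : Matrix (Fin d) (Fin n) ℝ → Matrix (Fin d) (Fin n) ℝ)
    (P : Matrix (Fin d) (Fin n) ℝ) : Matrix (Fin d) (Fin n) ℝ :=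
  Matrix.of fun i j => ∫ g in F, twist Φ P g i j ∂μ

end MFA

end

/-!
Since `φ(P)` spans the columns of `P`, the frame value is a coset `Q̂ K`, where `K = Stab(R̂)`. The
generalized QR decomposition puts an invertible triangular block into `d'` of the rows of `R̂` and
zeros elsewhere, so `K` consists of the matrices that fix the corresponding `d'` basis vectors. For
every other index `k` the group `K` contains the reflection that changes the sign of the `k`-th
coordinate, hence an average over `Q̂ K` that is invariant under right multiplication by `K` cancels
the `k`-th column. Pulled back to `K`, a uniform measure becomes a Haar probability measure, which
exists exactly when `K` is compact.
-/

open scoped Pointwise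

namespace MFA

section OrbitRepresentatives

variable {G α : Type*} [Group G] [MulAction G α]

theorem exists_orbit_representative_eq {a b : α} (hab : b ∈ MulAction.orbit G a) :
    ∃ c : α → α, (∀ (g : G) x, c (g • x) = c x) ∧ (∀ x, x ∈ MulAction.orbit G (c x)) ∧
      c a = b := by
  classical
  let s := MulAction.orbitRel G α
  let c : Quotient s → α := Function.update Quotient.out ⟦a⟧ b
  have hc (o : Quotient s) : ⟦c o⟧ = o := by
    obtain rfl | ho := eq_or_ne o ⟦a⟧
    · simpa only [c, Function.update_self] using Quotient.sound hab
    · simp only [c, Function.update_of_ne ho, Quotient.out_eq]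
  refine ⟨fun x => c ⟦x⟧, fun g x => ?_, fun x => Quotient.exact (hc ⟦x⟧).symm,
    Function.update_self ..⟩
  exact congrArg c (Quotient.sound (MulAction.mem_orbit x g))

end OrbitRepresentatives

section LeftCoset

variable {G : Type*} [Group G]

theorem range_mul_coe (K : Subgroup G) (q : G) :
    Set.range (fun k : K => q * (k : G)) = q • (K : Set G) := by
  rw [← Set.image_smul, ← Subtype.range_coe (s := (K : Set G)), ← Set.range_comp]
  rfl

theorem image_mul_coe_subset (K : Subgroup G) (q : G) (s : Set K) :
    (fun k : K => q * (k : G)) '' s ⊆ q • (K : Set G) :=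
  range_mul_coe K q ▸ Set.image_subset_range _ s

theorem isCompact_leftCoset_iff [TopologicalSpace G] [IsTopologicalGroup G]
    {K : Subgroup G} {q : G} : IsCompact (q • (K : Set G)) ↔ CompactSpace K := by
  refine Iff.trans ⟨fun h => ?_, fun h => h.smul q⟩ isCompact_iff_compactSpace
  simpa only [inv_smul_smul] using h.smul q⁻¹

end LeftCoset

section InvariantMeasure

variable {G : Type*} [Group G] [TopologicalSpace G] [IsTopologicalGroup G]
  [MeasurableSpace G] [BorelSpace G]

theorem compactSpace_of_isMulLeftInvariant [LocallyCompactSpace G] [SecondCountableTopology G]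
    [T2Space G] (μ : Measure G) [IsFiniteMeasure μ] [NeZero μ] [μ.IsMulLeftInvariant] :
    CompactSpace G := by
  by_contra h
  have : NoncompactSpace G := not_compactSpace_iff.1 h
  exact measure_ne_top μ Set.univ (measure_univ_of_isMulLeftInvariant μ)

theorem isMulRightInvariant_of_isHaarMeasure [CompactSpace G] (μ : Measure G)
    [μ.IsHaarMeasure] [IsProbabilityMeasure μ] : μ.IsMulRightInvariant where
  map_mul_right_eq_self g :=
    have : IsProbabilityMeasure (μ.map (· * g)) :=
      Measure.isProbabilityMeasure_map (measurable_mul_const g).aemeasurable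
    Measure.isHaarMeasure_eq_of_isProbabilityMeasure _ _

variable {K : Subgroup G}

theorem measurableEmbedding_mul_coe (hK : IsClosed (K : Set G)) (q : G) :
    MeasurableEmbedding fun k : K => q * (k : G) :=
  (MeasurableEquiv.mulLeft q).measurableEmbedding.comp (.subtype_coe hK.measurableSet)

/-- The measure on `K` that corresponds to a measure on the coset `q • K` under the
parametrization `k ↦ q * k`. -/
noncomputable def cosetPullback (K : Subgroup G) (q : G) (μ : Measure G) : Measure K :=
  μ.comap fun k => q * (k : G)

theorem cosetPullback_apply (hK : IsClosed (K : Set G)) (q : G) (μ : Measure G) (s : Set K) :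
    cosetPullback K q μ s = μ ((fun k : K => q * (k : G)) '' s) :=
  (measurableEmbedding_mul_coe hK q).comap_apply _ _

theorem map_cosetPullback (hK : IsClosed (K : Set G)) (q : G) (μ : Measure G) :
    (cosetPullback K q μ).map (fun k : K => q * (k : G)) = μ.restrict (q • (K : Set G)) := by
  rw [← range_mul_coe]
  exact (measurableEmbedding_mul_coe hK q).map_comap μ

theorem setIntegral_leftCoset (hK : IsClosed (K : Set G)) (q : G) (μ : Measure G) (f : G → ℝ) :
    ∫ g in q • (K : Set G), f g ∂μ = ∫ k : K, f (q * k) ∂cosetPullback K q μ := by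
  rw [← map_cosetPullback hK]
  exact (measurableEmbedding_mul_coe hK q).integral_map f

theorem map_mul_coe_image_mul_left (hK : IsClosed (K : Set G)) (ν : Measure K)
    [ν.IsMulLeftInvariant] {q g : G} {X : Set G} (hX : X ⊆ q • (K : Set G))
    (hgX : (fun h => g * h) '' X ⊆ q • (K : Set G)) :
    ν.map (fun k : K => q * (k : G)) ((fun h => g * h) '' X) =
      ν.map (fun k : K => q * (k : G)) X := by
  have he := measurableEmbedding_mul_coe hK q
  obtain rfl | ⟨x, hx⟩ := X.eq_empty_or_nonempty
  · rw [Set.image_empty]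
  obtain ⟨k, hk, rfl⟩ := hX hx
  obtain ⟨l, hl, hgl⟩ := hgX ⟨_, hx, rfl⟩
  obtain rfl : g = q * (l * k⁻¹) * q⁻¹ := by
    simp only [smul_eq_mul] at hgl
    rw [← mul_assoc, hgl]
    group
  rw [he.map_apply, he.map_apply,
    ← measure_preimage_mul ν ⟨l * k⁻¹, K.mul_mem hl (K.inv_mem hk)⟩]
  congr 1
  ext h
  have hmul : q * (l * k⁻¹ * h) = q * (l * k⁻¹) * q⁻¹ * (q * h) := by group
  change q * (l * k⁻¹ * h) ∈ (q * (l * k⁻¹) * q⁻¹ * ·) '' X ↔ q * (h : G) ∈ X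
  rw [hmul]
  exact (mul_right_injective _).mem_set_image

theorem map_mul_coe_image_mul_right (hK : IsClosed (K : Set G)) (ν : Measure K)
    [ν.IsMulRightInvariant] {q g : G} {X : Set G} (hX : X ⊆ q • (K : Set G))
    (hXg : (fun h => h * g) '' X ⊆ q • (K : Set G)) :
    ν.map (fun k : K => q * (k : G)) ((fun h => h * g) '' X) =
      ν.map (fun k : K => q * (k : G)) X := by
  have he := measurableEmbedding_mul_coe hK q
  obtain rfl | ⟨x, hx⟩ := X.eq_empty_or_nonempty
  · rw [Set.image_empty]
  obtain ⟨k, hk, rfl⟩ := hX hx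
  obtain ⟨l, hl, hgl⟩ := hXg ⟨_, hx, rfl⟩
  obtain rfl : g = k⁻¹ * l := by
    simp only [smul_eq_mul, mul_assoc, mul_right_inj] at hgl
    rw [hgl, inv_mul_cancel_left]
  rw [he.map_apply, he.map_apply,
    ← measure_preimage_mul_right ν ⟨k⁻¹ * l, K.mul_mem (K.inv_mem hk) hl⟩]
  congr 1
  ext h
  change q * (h * (k⁻¹ * l)) ∈ (· * (k⁻¹ * l)) '' X ↔ q * (h : G) ∈ X
  rw [← mul_assoc]
  exact (mul_left_injective _).mem_set_image

end InvariantMeasure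

section Topology

instance {m n R : Type*} [Countable m] [Countable n] [TopologicalSpace R]
    [SecondCountableTopology R] : SecondCountableTopology (Matrix m n R) :=
  inferInstanceAs (SecondCountableTopology (m → n → R))

instance {m n R : Type*} [Finite m] [Finite n] [TopologicalSpace R] [LocallyCompactSpace R] :
    LocallyCompactSpace (Matrix m n R) :=
  inferInstanceAs (LocallyCompactSpace (m → n → R))

instance {M : Type*} [Monoid M] [TopologicalSpace M] [SecondCountableTopology M] :
    SecondCountableTopology Mˣ :=
  have : SecondCountableTopology Mᵐᵒᵖ := MulOpposite.opHomeomorph.symm.secondCountableTopology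
  Units.isEmbedding_embedProduct.secondCountableTopology

instance {M : Type*} [Monoid M] [TopologicalSpace M] [T1Space M] [ContinuousMul M]
    [LocallyCompactSpace M] : LocallyCompactSpace Mˣ :=
  Units.isClosedEmbedding_embedProduct.locallyCompactSpace

variable {d : ℕ} {η : Fin d → ℝ}

theorem continuous_rho : Continuous (rho : Geta η → Matrix (Fin d) (Fin d) ℝ) :=
  Units.continuous_val.comp continuous_subtype_val

theorem isClosed_Geta (η : Fin d → ℝ) : IsClosed (Geta η : Set (GL (Fin d) ℝ)) := by
  have hval : Continuous fun g : GL (Fin d) ℝ => (g : Matrix (Fin d) (Fin d) ℝ) :=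
    Units.continuous_val
  exact isClosed_eq ((hval.matrix_transpose.mul continuous_const).mul hval) continuous_const

instance : SecondCountableTopology (Geta η) :=
  Topology.IsEmbedding.subtypeVal.secondCountableTopology

instance : LocallyCompactSpace (Geta η) :=
  (isClosed_Geta η).isClosedEmbedding_subtypeVal.locallyCompactSpace

end Topology

section ColumnProjection

variable {ι κ R : Type*} [Fintype ι] [DecidableEq ι] [Semiring R] {J : Finset ι}

/-- The coordinate projection onto the indices in `J`: multiplying by it on the right keeps the
columns with index in `J` and replaces the other columns by `0`. -/
def colProj (R : Type*) [Semiring R] (J : Finset ι) : Matrix ι ι R :=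
  diagonal fun k => if k ∈ J then 1 else 0

theorem mul_colProj_apply (A : Matrix κ ι R) (J : Finset ι) (i : κ) (k : ι) :
    (A * colProj R J) i k = if k ∈ J then A i k else 0 := by
  simp [colProj, mul_diagonal]

theorem col_mul_colProj_of_mem (A : Matrix κ ι R) {k : ι} (hk : k ∈ J) :
    (A * colProj R J).col k = A.col k := by
  ext i
  simp [mul_colProj_apply, hk]

theorem col_mul_colProj_of_notMem (A : Matrix κ ι R) {k : ι} (hk : k ∉ J) :
    (A * colProj R J).col k = 0 := by
  ext i
  simp [mul_colProj_apply, hk]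

theorem mul_colProj_eq_iff {A B : Matrix κ ι R} :
    A * colProj R J = B * colProj R J ↔ ∀ k ∈ J, A.col k = B.col k := by
  refine ⟨fun h k hk => ?_, fun h => ?_⟩
  · rw [← col_mul_colProj_of_mem A hk, h, col_mul_colProj_of_mem B hk]
  · ext i k
    simp only [mul_colProj_apply]
    split_ifs with hk
    exacts [congrFun (h k hk) i, rfl]

theorem colProj_univ : colProj R (Finset.univ : Finset ι) = 1 := by
  simp [colProj]

theorem mul_submatrix_one_id {m : Type*} (A : Matrix κ ι R) (f : m → ι) :
    A * (1 : Matrix ι ι R).submatrix id f = A.submatrix id f :=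
  mul_submatrix_one (Equiv.refl ι) f A

theorem mul_submatrix_one_eq_iff {m : Type*} [Fintype m] {A B : Matrix κ ι R} (f : m ↪ ι) :
    A * (1 : Matrix ι ι R).submatrix id f = B * (1 : Matrix ι ι R).submatrix id f ↔
      A * colProj R (Finset.univ.map f) = B * colProj R (Finset.univ.map f) := by
  simp only [mul_submatrix_one_id, mul_colProj_eq_iff, Finset.mem_map, Finset.mem_univ, true_and,
    forall_exists_index, forall_apply_eq_imp_iff]
  exact ⟨fun h j => funext fun i => congrFun (congrFun h i) j,
    fun h => Matrix.ext fun i j => congrFun (h j) i⟩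

end ColumnProjection

section Action

variable {d : ℕ} {η : Fin d → ℝ} {ι κ : Type*}

theorem rho_mul (g h : Geta η) : rho (g * h) = rho g * rho h := rfl

theorem rho_one : rho (1 : Geta η) = 1 := rfl

theorem rho_inv (g : Geta η) : rho g⁻¹ = (rho g)⁻¹ := by
  rw [eq_comm, inv_eq_left_inv]
  rw [← rho_mul, inv_mul_cancel, rho_one]

theorem rho_injective : Function.Injective (rho : Geta η → Matrix (Fin d) (Fin d) ℝ) :=
  Units.val_injective.comp Subtype.val_injective

theorem col_rho_ne_zero (g : Geta η) (k : Fin d) : (rho g).col k ≠ 0 :=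
  (linearIndependent_cols_of_isUnit (g : GL (Fin d) ℝ).isUnit).ne_zero k

instance : MulAction (Geta η) (Matrix (Fin d) ι ℝ) where
  smul g X := rho g * X
  one_smul := Matrix.one_mul
  mul_smul g h := Matrix.mul_assoc (rho g) (rho h)

theorem smul_eq_rho_mul (g : Geta η) (X : Matrix (Fin d) ι ℝ) : g • X = rho g * X := rfl

theorem isClosed_stabilizer (X : Matrix (Fin d) ι ℝ) :
    IsClosed (MulAction.stabilizer (Geta η) X : Set (Geta η)) :=
  isClosed_eq (continuous_rho.matrix_mul continuous_const) continuous_const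

theorem stabilizer_le_stabilizer_mul [Fintype ι] (X : Matrix (Fin d) ι ℝ) (N : Matrix ι κ ℝ) :
    MulAction.stabilizer (Geta η) X ≤ MulAction.stabilizer (Geta η) (X * N) := by
  intro g hg
  rw [MulAction.mem_stabilizer_iff, smul_eq_rho_mul] at hg ⊢
  rw [← Matrix.mul_assoc, hg]

theorem stabilizer_mul_of_isUnit_det [Fintype ι] [DecidableEq ι] (X : Matrix (Fin d) ι ℝ)
    {N : Matrix ι ι ℝ} (hN : IsUnit N.det) :
    MulAction.stabilizer (Geta η) (X * N) = MulAction.stabilizer (Geta η) X := by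
  refine le_antisymm ?_ (stabilizer_le_stabilizer_mul X N)
  simpa only [mul_nonsing_inv_cancel_right N X hN] using
    stabilizer_le_stabilizer_mul (η := η) (X * N) N⁻¹

theorem mem_stabilizer_iff_forall_mem_span {g : Geta η} {X : Matrix (Fin d) ι ℝ} :
    g ∈ MulAction.stabilizer (Geta η) X ↔
      ∀ v ∈ Submodule.span ℝ (Set.range X.col), rho g *ᵥ v = v := by
  have hspan : (∀ v ∈ Submodule.span ℝ (Set.range X.col), rho g *ᵥ v = v) ↔
      ∀ j, rho g *ᵥ X.col j = X.col j := by
    rw [← Set.forall_mem_range (p := fun v => rho g *ᵥ v = v)]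
    exact Submodule.span_le (p := LinearMap.eqLocus (rho g).mulVecLin LinearMap.id)
  rw [hspan, MulAction.mem_stabilizer_iff, smul_eq_rho_mul]
  exact ⟨fun h j => funext fun i => congrFun (congrFun h i) j,
    fun h => Matrix.ext fun i j => congrFun (h j) i⟩

theorem stabilizer_eq_of_span_col_eq {X : Matrix (Fin d) ι ℝ} {Y : Matrix (Fin d) κ ℝ}
    (h : Submodule.span ℝ (Set.range X.col) = Submodule.span ℝ (Set.range Y.col)) :
    MulAction.stabilizer (Geta η) X = MulAction.stabilizer (Geta η) Y := by
  ext g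
  rw [mem_stabilizer_iff_forall_mem_span, mem_stabilizer_iff_forall_mem_span, h]

theorem stabilizer_smul_eq_of_span_col_eq (g : Geta η) {X : Matrix (Fin d) ι ℝ}
    {Y : Matrix (Fin d) κ ℝ}
    (h : Submodule.span ℝ (Set.range X.col) = Submodule.span ℝ (Set.range Y.col)) :
    MulAction.stabilizer (Geta η) (g • X) = MulAction.stabilizer (Geta η) (g • Y) := by
  rw [MulAction.stabilizer_smul_eq_stabilizer_map_conj,
    MulAction.stabilizer_smul_eq_stabilizer_map_conj, stabilizer_eq_of_span_col_eq h]

theorem qrFrame_smul {m : ℕ} (q : Geta η) (X : Matrix (Fin d) (Fin m) ℝ) :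
    qrFrame η (q • X) X = q • (MulAction.stabilizer (Geta η) X : Set (Geta η)) := by
  ext g
  rw [mem_leftCoset_iff, SetLike.mem_coe, MulAction.mem_stabilizer_iff, mul_smul, inv_smul_eq_iff]
  rfl

end Action

section MinimalFrame

variable {d n : ℕ} {η : Fin d → ℝ} {c : Matrix (Fin d) (Fin n) ℝ → Matrix (Fin d) (Fin n) ℝ}

theorem isFrame_qrFrame (hinv : ∀ (g : Geta η) X, c (g • X) = c X)
    (horbit : ∀ X, X ∈ MulAction.orbit (Geta η) (c X)) :
    IsFrame η fun X => qrFrame η X (c X) := by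
  refine ⟨horbit, fun g X => ?_⟩
  change qrFrame η (g • X) (c (g • X)) = g • qrFrame η X (c X)
  ext h
  rw [hinv, Set.mem_smul_set_iff_inv_smul_mem]
  change h • c X = g • X ↔ (g⁻¹ * h) • c X = X
  rw [mul_smul, inv_smul_eq_iff]

theorem isMinimalFrame_qrFrame (hinv : ∀ (g : Geta η) X, c (g • X) = c X)
    (horbit : ∀ X, X ∈ MulAction.orbit (Geta η) (c X)) :
    IsMinimalFrame η fun X => qrFrame η X (c X) := by
  refine ⟨isFrame_qrFrame hinv horbit, ?_⟩
  rintro X F ⟨hne, hequiv⟩ ⟨hsub, hnsub⟩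
  obtain ⟨h, hh⟩ := hne X
  have hX : h • c X = X := hsub hh
  refine hnsub fun g (hg : g • c X = X) => ?_
  -- `g * h⁻¹` fixes `X`, so equivariance puts `g` into `F X` together with `h`.
  have hfix : (g * h⁻¹) • X = X := by rw [mul_smul, inv_smul_eq_iff.2 hX.symm, hg]
  rw [← hfix]
  exact hequiv (g * h⁻¹) X ▸ ⟨h, hh, inv_mul_cancel_right g h⟩

theorem exists_isMinimalFrame_apply_eq {P C : Matrix (Fin d) (Fin n) ℝ}
    (hC : C ∈ MulAction.orbit (Geta η) P) : ∃ F, IsMinimalFrame η F ∧ F P = qrFrame η P C := by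
  obtain ⟨c, hinv, horbit, rfl⟩ := exists_orbit_representative_eq hC
  exact ⟨_, isMinimalFrame_qrFrame hinv horbit, rfl⟩

end MinimalFrame

section UniformMeasure

variable {d : ℕ} {η : Fin d → ℝ} {K : Subgroup (Geta η)} {q : Geta η} {μ : Measure (Geta η)}

theorem IsUniformOn.isProbabilityMeasure_cosetPullback (hK : IsClosed (K : Set (Geta η)))
    (hμ : IsUniformOn (q • (K : Set (Geta η))) μ) :
    IsProbabilityMeasure (cosetPullback K q μ) := by
  have := hμ.prob
  constructor
  rw [cosetPullback_apply hK, Set.image_univ, range_mul_coe,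
    ← prob_compl_eq_zero_iff (hK.leftCoset q).measurableSet]
  exact hμ.concentrated

theorem IsUniformOn.isMulLeftInvariant_cosetPullback (hK : IsClosed (K : Set (Geta η)))
    (hμ : IsUniformOn (q • (K : Set (Geta η))) μ) :
    (cosetPullback K q μ).IsMulLeftInvariant := by
  refine ⟨fun k => Measure.ext fun s hs => ?_⟩
  rw [Measure.map_apply (measurable_const_mul k) hs, cosetPullback_apply hK,
    cosetPullback_apply hK]
  set t := (k * ·) ⁻¹' s
  have ht : (k * ·) '' t = s := Set.image_preimage_eq s (mul_left_surjective k)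
  have himage : (fun h => q * k * q⁻¹ * h) '' ((fun x : K => q * (x : Geta η)) '' t) =
      (fun x : K => q * (x : Geta η)) '' s := by
    rw [← ht, Set.image_image, Set.image_image]
    simp [mul_assoc]
  rw [← himage]
  exact (hμ.left_invariant _ _ ((measurableEmbedding_mul_coe hK q).measurableSet_image.2
    (measurable_const_mul k hs)) (image_mul_coe_subset K q t)
      (himage ▸ image_mul_coe_subset K q s)).symm

theorem IsUniformOn.isMulRightInvariant_cosetPullback (hK : IsClosed (K : Set (Geta η)))
    (hμ : IsUniformOn (q • (K : Set (Geta η))) μ) :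
    (cosetPullback K q μ).IsMulRightInvariant := by
  refine ⟨fun k => Measure.ext fun s hs => ?_⟩
  rw [Measure.map_apply (measurable_mul_const k) hs, cosetPullback_apply hK,
    cosetPullback_apply hK]
  set t := (· * k) ⁻¹' s
  have ht : (· * k) '' t = s := Set.image_preimage_eq s (mul_right_surjective k)
  have himage : (fun h => h * (k : Geta η)) '' ((fun x : K => q * (x : Geta η)) '' t) =
      (fun x : K => q * (x : Geta η)) '' s := by
    rw [← ht, Set.image_image, Set.image_image]
    simp [mul_assoc]
  rw [← himage]
  exact (hμ.right_invariant _ _ ((measurableEmbedding_mul_coe hK q).measurableSet_image.2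
    (measurable_mul_const k hs)) (image_mul_coe_subset K q t)
      (himage ▸ image_mul_coe_subset K q s)).symm

theorem IsUniformOn.isCompact (hK : IsClosed (K : Set (Geta η)))
    (hμ : IsUniformOn (q • (K : Set (Geta η))) μ) : IsCompact (q • (K : Set (Geta η))) := by
  have := hμ.isProbabilityMeasure_cosetPullback hK
  have := hμ.isMulLeftInvariant_cosetPullback hK
  have : LocallyCompactSpace K := hK.isClosedEmbedding_subtypeVal.locallyCompactSpace
  have : SecondCountableTopology K := Topology.IsEmbedding.subtypeVal.secondCountableTopology
  exact isCompact_leftCoset_iff.2 (compactSpace_of_isMulLeftInvariant (cosetPullback K q μ))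

theorem isUniformOn_map_mul_coe (hK : IsClosed (K : Set (Geta η))) (q : Geta η) (ν : Measure K)
    [IsProbabilityMeasure ν] [ν.IsMulLeftInvariant] [ν.IsMulRightInvariant] :
    IsUniformOn (q • (K : Set (Geta η))) (ν.map fun k : K => q * (k : Geta η)) where
  prob := Measure.isProbabilityMeasure_map
    (measurableEmbedding_mul_coe hK q).measurable.aemeasurable
  concentrated := by
    rw [(measurableEmbedding_mul_coe hK q).map_apply, ← range_mul_coe, Set.preimage_compl,
      Set.preimage_range, Set.compl_univ, measure_empty]
  left_invariant _ _ _ := map_mul_coe_image_mul_left hK ν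
  right_invariant _ _ _ := map_mul_coe_image_mul_right hK ν

theorem exists_isUniformOn_leftCoset_iff (hK : IsClosed (K : Set (Geta η))) :
    (∃ μ, IsUniformOn (q • (K : Set (Geta η))) μ) ↔ IsCompact (q • (K : Set (Geta η))) := by
  refine ⟨fun ⟨μ, hμ⟩ => hμ.isCompact hK, fun hcompact => ?_⟩
  have : CompactSpace K := isCompact_leftCoset_iff.1 hcompact
  let ν : Measure K := Measure.haarMeasure ⊤
  have : IsProbabilityMeasure ν := ⟨Measure.haarMeasure_self⟩
  have : ν.IsMulRightInvariant := isMulRightInvariant_of_isHaarMeasure ν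
  exact ⟨_, isUniformOn_map_mul_coe hK q ν⟩

end UniformMeasure

section GeneralizedQR

variable {d m : ℕ} {η : Fin d → ℝ} {A : Matrix (Fin d) (Fin m) ℝ} {q : Geta η}
  {Rhat : Matrix (Fin d) (Fin m) ℝ}

theorem IsGenQR.smul_eq (h : IsGenQR η A q Rhat) : q • Rhat = A := by
  obtain ⟨Q, ε, R, σ, -, -, -, -, rfl, hq, rfl⟩ := h
  have hσ : σ.permMatrix ℝ * (σ.permMatrix ℝ)ᵀ = 1 := by
    rw [transpose_permMatrix, ← permMatrix_mul, inv_mul_cancel, permMatrix_one]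
  rw [smul_eq_rho_mul, hq]
  simp only [Matrix.mul_assoc]
  rw [← Matrix.mul_assoc (σ.permMatrix ℝ), hσ, Matrix.one_mul]

theorem submatrix_one_castLE_mul {hm : m ≤ d} {W : Matrix (Fin d) (Fin m) ℝ}
    (hW : ∀ (i : Fin d) (j : Fin m), j.val < i.val → W i j = 0) :
    (1 : Matrix (Fin d) (Fin d) ℝ).submatrix id (Fin.castLE hm) *
      W.submatrix (Fin.castLE hm) id = W := by
  ext i j
  obtain hi | hi := lt_or_ge i.val m
  · obtain ⟨i, rfl⟩ : ∃ k : Fin m, Fin.castLE hm k = i := ⟨⟨i, hi⟩, rfl⟩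
    simp [mul_apply, one_apply]
  · have hne (k : Fin m) : i ≠ Fin.castLE hm k := fun h => by
      have := congrArg Fin.val h
      simp only [Fin.val_castLE] at this
      omega
    simp [mul_apply, one_apply, hne, hW i j (by omega)]

theorem isUnit_det_submatrix_castLE {hm : m ≤ d} {W : Matrix (Fin d) (Fin m) ℝ}
    (hW : ∀ (i : Fin d) (j : Fin m), j.val < i.val → W i j = 0)
    (hdiag : ∀ (i : Fin d) (j : Fin m), i.val = j.val → W i j ≠ 0) :
    IsUnit (W.submatrix (Fin.castLE hm) id).det := by
  have htri : (W.submatrix (Fin.castLE hm) id).IsUpperTriangular :=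
    fun i j hij => hW (Fin.castLE hm i) j hij
  rw [isUnit_iff_ne_zero, det_of_isUpperTriangular htri, Finset.prod_ne_zero_iff]
  exact fun j _ => hdiag _ j rfl

theorem IsGenQR.exists_eq_submatrix_one_mul (h : IsGenQR η A q Rhat) (hm : m ≤ d) :
    ∃ (f : Fin m ↪ Fin d) (U : Matrix (Fin m) (Fin m) ℝ), IsUnit U.det ∧
      Rhat = (1 : Matrix (Fin d) (Fin d) ℝ).submatrix id f * U := by
  obtain ⟨Q, ε, R, σ, hε, -, hlow, hpos, -, -, rfl⟩ := h
  have hlow' (i : Fin d) (j : Fin m) (hij : j.val < i.val) : (diagonal ε * R) i j = 0 := by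
    rw [diagonal_mul, hlow i j hij, mul_zero]
  have hdiag (i : Fin d) (j : Fin m) (hij : i.val = j.val) : (diagonal ε * R) i j ≠ 0 := by
    rw [diagonal_mul]
    exact mul_ne_zero (by rcases hε i with h | h <;> simp [h]) (hpos i j hij).ne'
  refine ⟨(Fin.castLEEmb hm).trans σ.toEmbedding, _,
    isUnit_det_submatrix_castLE (hm := hm) hlow' hdiag, ?_⟩
  have hperm : (σ.permMatrix ℝ)ᵀ * (1 : Matrix (Fin d) (Fin d) ℝ).submatrix id (Fin.castLE hm) =
      (1 : Matrix (Fin d) (Fin d) ℝ).submatrix id ((Fin.castLEEmb hm).trans σ.toEmbedding) := by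
    rw [Equiv.Perm.permMatrix, PEquiv.toMatrix_toPEquiv_eq, transpose_submatrix, transpose_one,
      mul_submatrix_one_id]
    rfl
  rw [← hperm, Matrix.mul_assoc, Matrix.mul_assoc, submatrix_one_castLE_mul hlow']

end GeneralizedQR

section DeterminedColumns

variable {d : ℕ} {η : Fin d → ℝ} {J : Finset (Fin d)} {q g : Geta η} {k : Fin d}

/-- The subgroup of those `g ∈ G_η(d)` which fix the basis vectors `e k`, `k ∈ J`. The frames
considered here are left cosets of such subgroups. -/
def colStabilizer (η : Fin d → ℝ) (J : Finset (Fin d)) : Subgroup (Geta η) :=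
  MulAction.stabilizer (Geta η) (colProj ℝ J)

theorem isClosed_colStabilizer (η : Fin d → ℝ) (J : Finset (Fin d)) :
    IsClosed (colStabilizer η J : Set (Geta η)) :=
  isClosed_stabilizer _

theorem mem_smul_colStabilizer_iff :
    g ∈ q • (colStabilizer η J : Set (Geta η)) ↔ ∀ k ∈ J, (rho g).col k = (rho q).col k := by
  rw [mem_leftCoset_iff, SetLike.mem_coe, colStabilizer, MulAction.mem_stabilizer_iff, mul_smul,
    inv_smul_eq_iff]
  exact mul_colProj_eq_iff

theorem colStabilizer_univ : colStabilizer η Finset.univ = ⊥ := by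
  refine (Subgroup.eq_bot_iff_forall _).2 fun g hg => rho_injective ?_
  rw [colStabilizer, MulAction.mem_stabilizer_iff, smul_eq_rho_mul, colProj_univ,
    Matrix.mul_one] at hg
  rw [hg, rho_one]

/-- The reflection in `G_η(d)` which changes the sign of the `k`-th coordinate. -/
def reflection (η : Fin d → ℝ) (k : Fin d) : Geta η :=
  let D : Matrix (Fin d) (Fin d) ℝ := diagonal (Function.update 1 k (-1))
  have hD : D * D = 1 := by
    rw [diagonal_mul_diagonal, ← diagonal_one, diagonal_eq_diagonal_iff]
    intro i
    obtain rfl | hi := eq_or_ne i k <;> simp [*]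
  ⟨⟨D, D, hD, hD⟩, by
    change Dᵀ * diagonal η * D = diagonal η
    rw [diagonal_transpose, (commute_diagonal _ η).eq, Matrix.mul_assoc, hD, Matrix.mul_one]⟩

theorem rho_mul_reflection_apply (g : Geta η) (i k l : Fin d) :
    rho (g * reflection η k) i l = if l = k then -rho g i l else rho g i l := by
  rw [rho_mul]
  change (rho g * diagonal (Function.update 1 k (-1)) : Matrix _ _ ℝ) i l = _
  rw [mul_diagonal, Function.update_apply]
  split_ifs <;> simp

theorem col_rho_mul_reflection_self (g : Geta η) (k : Fin d) :
    (rho (g * reflection η k)).col k = -(rho g).col k := by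
  ext i
  simp [rho_mul_reflection_apply]

theorem reflection_mem_colStabilizer (hk : k ∉ J) : reflection η k ∈ colStabilizer η J := by
  rw [colStabilizer, MulAction.mem_stabilizer_iff]
  have h : rho (reflection η k) * colProj ℝ J = 1 * colProj ℝ J :=
    mul_colProj_eq_iff.2 fun l hl => by
      ext i
      rw [← one_mul (reflection η k), col_apply, rho_mul_reflection_apply,
        if_neg (ne_of_mem_of_not_mem hl hk), rho_one, col_apply]
  rw [smul_eq_rho_mul, h, Matrix.one_mul]

theorem mem_iff_forall_col_eq :
    k ∈ J ↔ ∀ g ∈ q • (colStabilizer η J : Set (Geta η)), (rho g).col k = (rho q).col k := by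
  refine ⟨fun hk g hg => mem_smul_colStabilizer_iff.1 hg k hk, fun h => ?_⟩
  by_contra hk
  have hcol := h _ (Set.smul_mem_smul_set (a := q) (reflection_mem_colStabilizer hk))
  rw [smul_eq_mul, col_rho_mul_reflection_self] at hcol
  exact col_rho_ne_zero q k (neg_eq_self.1 hcol)

theorem IsGenQR.exists_stabilizer_eq_colStabilizer {m : ℕ} {A Rhat : Matrix (Fin d) (Fin m) ℝ}
    (h : IsGenQR η A q Rhat) (hm : m ≤ d) :
    ∃ J : Finset (Fin d), J.card = m ∧
      MulAction.stabilizer (Geta η) Rhat = colStabilizer η J := by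
  obtain ⟨f, U, hU, rfl⟩ := h.exists_eq_submatrix_one_mul hm
  refine ⟨Finset.univ.map f, by simp, ?_⟩
  rw [stabilizer_mul_of_isUnit_det _ hU]
  ext g
  rw [colStabilizer, MulAction.mem_stabilizer_iff, MulAction.mem_stabilizer_iff,
    smul_eq_rho_mul, smul_eq_rho_mul]
  simpa only [Matrix.one_mul] using mul_submatrix_one_eq_iff (A := rho g) (B := 1) f

end DeterminedColumns

section Average

variable {d n : ℕ} {η : Fin d → ℝ} {J : Finset (Fin d)} {q : Geta η} {μ : Measure (Geta η)}
  {P : Matrix (Fin d) (Fin n) ℝ} {g : Geta η}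

theorem inv_card_smul_sum_rho (hF : (q • (colStabilizer η J : Set (Geta η))).Finite) :
    (hF.toFinset.card : ℝ)⁻¹ • ∑ g ∈ hF.toFinset, rho g = rho q * colProj ℝ J := by
  have hne : (hF.toFinset.card : ℝ) ≠ 0 := by
    rw [Nat.cast_ne_zero, Finset.card_ne_zero, Set.Finite.toFinset_nonempty]
    exact ⟨q, mem_smul_colStabilizer_iff.2 fun _ _ => rfl⟩
  ext i k
  rw [mul_colProj_apply, Matrix.smul_apply, Matrix.sum_apply]
  split_ifs with hk
  · have hconst (g) (hg : g ∈ hF.toFinset) : rho g i k = rho q i k :=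
      congrFun (mem_smul_colStabilizer_iff.1 (hF.mem_toFinset.1 hg) k hk) i
    rw [Finset.sum_congr rfl hconst, Finset.sum_const, ← Nat.cast_smul_eq_nsmul ℝ,
      inv_smul_smul₀ hne]
  · have hsum : ∑ g ∈ hF.toFinset, rho g i k = ∑ g ∈ hF.toFinset, -rho g i k := by
      refine Finset.sum_equiv (Equiv.mulRight (reflection η k)) (fun g => ?_) fun g _ => ?_
      · simp only [hF.mem_toFinset, mem_leftCoset_iff, SetLike.mem_coe, Equiv.coe_mulRight,
          ← mul_assoc, Subgroup.mul_mem_cancel_right _ (reflection_mem_colStabilizer hk)]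
      · simp [rho_mul_reflection_apply]
    rw [Finset.sum_neg_distrib, self_eq_neg] at hsum
    rw [hsum, smul_zero]

theorem IsUniformOn.setIntegral_rho (hμ : IsUniformOn (q • (colStabilizer η J : Set (Geta η))) μ)
    (i k : Fin d) :
    ∫ g in q • (colStabilizer η J : Set (Geta η)), rho g i k ∂μ =
      (rho q * colProj ℝ J) i k := by
  have hK := isClosed_colStabilizer η J
  have := hμ.isProbabilityMeasure_cosetPullback hK
  have := hμ.isMulRightInvariant_cosetPullback hK
  rw [setIntegral_leftCoset hK, mul_colProj_apply]
  split_ifs with hk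
  · have hconst (h : colStabilizer η J) : rho (q * (h : Geta η)) i k = rho q i k :=
      congrFun (mem_smul_colStabilizer_iff.1 (Set.smul_mem_smul_set h.2) k hk) i
    simp only [hconst, integral_const, probReal_univ, one_smul]
  · let s : colStabilizer η J := ⟨reflection η k, reflection_mem_colStabilizer hk⟩
    have hneg := integral_mul_right_eq_self (μ := cosetPullback (colStabilizer η J) q μ)
      (fun h => rho (q * (h : Geta η)) i k) s
    simp only [s, Subgroup.coe_mul, ← mul_assoc, rho_mul_reflection_apply, if_true,
      integral_neg] at hneg
    exact neg_eq_self.1 hneg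

theorem twist_eq (Φ : Matrix (Fin d) (Fin n) ℝ → Matrix (Fin d) (Fin n) ℝ)
    (hg : g ∈ q • (MulAction.stabilizer (Geta η) (q⁻¹ • P) : Set (Geta η))) :
    twist Φ P g = rho g * Φ ((rho q)⁻¹ * P) := by
  have hP : g⁻¹ • P = q⁻¹ • P := by
    rwa [mem_leftCoset_iff, SetLike.mem_coe, MulAction.mem_stabilizer_iff, mul_smul,
      smul_left_cancel_iff, ← eq_inv_smul_iff, eq_comm] at hg
  rw [twist, ← rho_inv q]
  exact congrArg (rho g * Φ ·) hP

theorem finFrameAverage_eq (hF : (q • (colStabilizer η J : Set (Geta η))).Finite)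
    (hP : colStabilizer η J ≤ MulAction.stabilizer (Geta η) (q⁻¹ • P))
    (Φ : Matrix (Fin d) (Fin n) ℝ → Matrix (Fin d) (Fin n) ℝ) :
    finFrameAverage hF.toFinset Φ P = rho q * colProj ℝ J * Φ ((rho q)⁻¹ * P) := by
  rw [finFrameAverage, Finset.sum_congr rfl fun g hg =>
    twist_eq Φ (Set.smul_set_mono hP (hF.mem_toFinset.1 hg)), ← Matrix.sum_mul,
    ← smul_mul, inv_card_smul_sum_rho]

theorem IsUniformOn.integrableOn_rho
    (hμ : IsUniformOn (q • (colStabilizer η J : Set (Geta η))) μ) (i k : Fin d) :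
    IntegrableOn (fun g => rho g i k) (q • (colStabilizer η J : Set (Geta η))) μ := by
  have := hμ.prob
  exact (continuous_rho.matrix_elem i k).continuousOn.integrableOn_compact
    (hμ.isCompact (isClosed_colStabilizer η J))

theorem IsUniformOn.integrableOn_twist
    (hμ : IsUniformOn (q • (colStabilizer η J : Set (Geta η))) μ)
    (hP : colStabilizer η J ≤ MulAction.stabilizer (Geta η) (q⁻¹ • P))
    (Φ : Matrix (Fin d) (Fin n) ℝ → Matrix (Fin d) (Fin n) ℝ) (i : Fin d) (j : Fin n) :
    IntegrableOn (fun g => twist Φ P g i j) (q • (colStabilizer η J : Set (Geta η))) μ := by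
  have hmeas := ((isClosed_colStabilizer η J).leftCoset q).measurableSet
  refine IntegrableOn.congr_fun (f := fun g => ∑ k, rho g i k * Φ ((rho q)⁻¹ * P) k j) ?_
    (fun g hg => ?_) hmeas
  · exact integrable_finsetSum _ fun k _ => (hμ.integrableOn_rho i k).mul_const _
  · rw [twist_eq Φ (Set.smul_set_mono hP hg), mul_apply]

theorem IsUniformOn.frameAverage_eq
    (hμ : IsUniformOn (q • (colStabilizer η J : Set (Geta η))) μ)
    (hP : colStabilizer η J ≤ MulAction.stabilizer (Geta η) (q⁻¹ • P))
    (Φ : Matrix (Fin d) (Fin n) ℝ → Matrix (Fin d) (Fin n) ℝ) :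
    frameAverage (q • (colStabilizer η J : Set (Geta η))) μ Φ P =
      rho q * colProj ℝ J * Φ ((rho q)⁻¹ * P) := by
  have hmeas := ((isClosed_colStabilizer η J).leftCoset q).measurableSet
  ext i j
  calc
    ∫ g in q • (colStabilizer η J : Set (Geta η)), twist Φ P g i j ∂μ
      = ∫ g in q • (colStabilizer η J : Set (Geta η)),
          ∑ k, rho g i k * Φ ((rho q)⁻¹ * P) k j ∂μ :=
        setIntegral_congr_fun hmeas fun g hg => by
          rw [twist_eq Φ (Set.smul_set_mono hP hg), mul_apply]
    _ = ∑ k, (rho q * colProj ℝ J) i k * Φ ((rho q)⁻¹ * P) k j := by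
        rw [integral_finsetSum _ fun k _ => (hμ.integrableOn_rho i k).mul_const _]
        simp only [integral_mul_const, hμ.setIntegral_rho]
    _ = (rho q * colProj ℝ J * Φ ((rho q)⁻¹ * P)) i j := (mul_apply ..).symm

end Average

section Selection

variable {d n d' : ℕ} {η : Fin d → ℝ} {P : Matrix (Fin d) (Fin n) ℝ} {sel : Fin d' ↪o Fin n}

theorem col_phi (sel : Fin d' ↪o Fin n) (P : Matrix (Fin d) (Fin n) ℝ) :
    (phi sel P).col = P.col ∘ sel := by
  rw [phi, selMatrix, mul_submatrix_one_id]
  rfl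

theorem IsSelection.span_col_phi_eq (h : IsSelection η P sel) (hP : ∀ j, ¬ IsNull η (P.col j)) :
    Submodule.span ℝ (Set.range (phi sel P).col) = Submodule.span ℝ (Set.range P.col) := by
  rw [col_phi]
  refine le_antisymm (Submodule.span_mono (Set.range_comp_subset_range _ _)) ?_
  rw [Submodule.span_le, Set.range_subset_iff]
  exact fun j => h.mem_span j (hP j)

theorem IsSelection.le (h : IsSelection η P sel) : d' ≤ d := by
  simpa using h.linearIndependent.fintype_card_le_finrank

end Selection

end MFA

theorem mainTheorem3_general {d n m : ℕ} (η : Fin d → ℝ) (P : Matrix (Fin d) (Fin n) ℝ)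
    (A : Matrix (Fin d) (Fin m) ℝ) (hm : m ≤ d)
    (hA : Submodule.span ℝ (Set.range A.col) = Submodule.span ℝ (Set.range P.col))
    (Qhat : MFA.Geta η) (Rhat : Matrix (Fin d) (Fin m) ℝ) (hQR : MFA.IsGenQR η A Qhat Rhat) :
    (∃ F : Matrix (Fin d) (Fin n) ℝ → Set (MFA.Geta η),
      MFA.IsMinimalFrame η F ∧ F P = MFA.qrFrame η A Rhat) ∧
    (m = d → MFA.qrFrame η A Rhat = {Qhat}) ∧
    ((∃ μ, MFA.IsUniformOn (MFA.qrFrame η A Rhat) μ) ↔ IsCompact (MFA.qrFrame η A Rhat)) ∧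
    ∃ (Q₀ : Matrix (Fin d) (Fin d) ℝ) (J : Finset (Fin d)),
      J.card = m ∧
      (∀ k, k ∈ J ↔ ∀ g ∈ MFA.qrFrame η A Rhat, (MFA.rho g).col k = (MFA.rho Qhat).col k) ∧
      (∀ k ∈ J, Q₀.col k = (MFA.rho Qhat).col k) ∧
      (∀ k ∉ J, Q₀.col k = 0) ∧
      ∀ Φ : Matrix (Fin d) (Fin n) ℝ → Matrix (Fin d) (Fin n) ℝ,
        (∀ hF : (MFA.qrFrame η A Rhat).Finite,
          MFA.finFrameAverage hF.toFinset Φ P = Q₀ * Φ ((MFA.rho Qhat)⁻¹ * P)) ∧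
        ∀ μ, MFA.IsUniformOn (MFA.qrFrame η A Rhat) μ →
          (∀ i j, IntegrableOn (fun g => MFA.twist Φ P g i j) (MFA.qrFrame η A Rhat) μ) ∧
          MFA.frameAverage (MFA.qrFrame η A Rhat) μ Φ P = Q₀ * Φ ((MFA.rho Qhat)⁻¹ * P) := by
  obtain ⟨J, hcard, hJ⟩ := hQR.exists_stabilizer_eq_colStabilizer hm
  have hstab : MulAction.stabilizer (MFA.Geta η) (Qhat⁻¹ • P) = MFA.colStabilizer η J := by
    rw [← hJ, ← inv_smul_eq_iff.2 hQR.smul_eq.symm]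
    exact (MFA.stabilizer_smul_eq_of_span_col_eq Qhat⁻¹ hA).symm
  have hframe : MFA.qrFrame η A Rhat = Qhat • (MFA.colStabilizer η J : Set (MFA.Geta η)) := by
    rw [← hJ, ← MFA.qrFrame_smul, hQR.smul_eq]
  have hmin : ∃ F, MFA.IsMinimalFrame η F ∧ F P = MFA.qrFrame η A Rhat := by
    rw [hframe, ← hstab, ← MFA.qrFrame_smul, smul_inv_smul]
    exact MFA.exists_isMinimalFrame_apply_eq (MulAction.mem_orbit P Qhat⁻¹)
  rw [hframe] at hmin ⊢
  refine ⟨hmin, fun hmd => ?_,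
    MFA.exists_isUniformOn_leftCoset_iff (MFA.isClosed_colStabilizer η J),
    MFA.rho Qhat * MFA.colProj ℝ J, J, hcard, fun k => MFA.mem_iff_forall_col_eq,
    fun k => MFA.col_mul_colProj_of_mem _, fun k => MFA.col_mul_colProj_of_notMem _,
    fun Φ => ⟨fun hF => MFA.finFrameAverage_eq hF hstab.ge Φ, fun μ hμ =>
      ⟨hμ.integrableOn_twist hstab.ge Φ, hμ.frameAverage_eq hstab.ge Φ⟩⟩⟩
  obtain rfl : J = Finset.univ := Finset.eq_univ_of_card J (by simp [hcard, hmd])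
  simp [MFA.colStabilizer_univ]

theorem mainTheorem3 {d n d' : ℕ} (η : Fin d → ℝ) (hη : ∀ i, η i = 1 ∨ η i = -1)
    (P : Matrix (Fin d) (Fin n) ℝ) (hP : ∀ j, ¬ MFA.IsNull η (P.col j))
    (sel : Fin d' ↪o Fin n) (hsel : MFA.IsSelection η P sel)
    (Qhat : MFA.Geta η) (Rhat : Matrix (Fin d) (Fin d') ℝ)
    (hQR : MFA.IsGenQR η (MFA.phi sel P) Qhat Rhat) :
    -- the frame is the value at `P` of a minimal frame on `ℝ^{d × n}`
    (∃ F : Matrix (Fin d) (Fin n) ℝ → Set (MFA.Geta η),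
      MFA.IsMinimalFrame η F ∧ F P = MFA.qrFrame η (MFA.phi sel P) Rhat) ∧
    -- it is a single point if `d' = d`
    (d' = d → MFA.qrFrame η (MFA.phi sel P) Rhat = {Qhat}) ∧
    -- it carries a uniform probability measure exactly if it is compact
    ((∃ μ, MFA.IsUniformOn (MFA.qrFrame η (MFA.phi sel P) Rhat) μ) ↔
      IsCompact (MFA.qrFrame η (MFA.phi sel P) Rhat)) ∧
    ∃ (Q₀ : Matrix (Fin d) (Fin d) ℝ) (J : Finset (Fin d)),
      J.card = d' ∧
      -- `J` indexes the determined columns, those shared by all elements of the frame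
      (∀ k, k ∈ J ↔ ∀ g ∈ MFA.qrFrame η (MFA.phi sel P) Rhat,
        (MFA.rho g).col k = (MFA.rho Qhat).col k) ∧
      (∀ k ∈ J, Q₀.col k = (MFA.rho Qhat).col k) ∧
      (∀ k ∉ J, Q₀.col k = 0) ∧
      ∀ Φ : Matrix (Fin d) (Fin n) ℝ → Matrix (Fin d) (Fin n) ℝ,
        -- average over a finite frame
        (∀ hF : (MFA.qrFrame η (MFA.phi sel P) Rhat).Finite,
          MFA.finFrameAverage hF.toFinset Φ P = Q₀ * Φ ((MFA.rho Qhat)⁻¹ * P)) ∧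
        -- integral average
        ∀ μ, MFA.IsUniformOn (MFA.qrFrame η (MFA.phi sel P) Rhat) μ →
          (∀ i j, IntegrableOn (fun g => MFA.twist Φ P g i j)
            (MFA.qrFrame η (MFA.phi sel P) Rhat) μ) ∧
          MFA.frameAverage (MFA.qrFrame η (MFA.phi sel P) Rhat) μ Φ P =
            Q₀ * Φ ((MFA.rho Qhat)⁻¹ * P) := by
  exact mainTheorem3_general η P _ hsel.le (hsel.span_col_phi_eq hP) Qhat Rhat hQR
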